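/- For an integer $n\ge 0$, let $r_n$ be the number of regions (connected components of the complement of the union of the hyperplanes) of the Catalan arrangement in $\mathbb R^n$, which consists of the hyperplanes $x_j = x_i + g$ with $1\le i<j\le n$ and $g\in\{-1,0,1\}$. Let $r'_n$ be the number of regions of the semiorder arrangement in $\mathbb R^n$, which consists of the hyperplanes $x_j = x_i + g$ with $1\le i<j\le n$ and $g\in\{-1,1\}$. Let $c(n,j)$ be the unsigned Stirling number of the first kind, that is, the number of permutations of $\{1,\dots,n\}$ with exactly $j$ cycles, where fixed points count as cycles. Then, for every $n\ge 0$, $$ r_n = \sum_{j=0}^{n} c(n,j)\, r'_j , $$ where for $n\ge 1$ the term $j=0$ vanishes because $c(n,0)=0$. -/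

import Mathlib

open Set

/-- An integral gain graph with vertex set `V`: a graph (loops and multiple edges allowed) in which
every edge carries a gain in the additive group `ℤ`. Each edge `e` is listed with one of its two
orientations, from `tail e` to `head e`, and `gain e` is its gain in that direction; in the
opposite direction its gain is `-gain e`. -/
structure IntegralGainGraph (V : Type) where
  Edge : Type
  tail : Edge → V
  head : Edge → V
  gain : Edge → ℤ

namespace IntegralGainGraph

/-- The gain graph `A K_n`: the complete graph on `n` vertices, where each edge `ij`, `i < j`, is
replaced by one edge of gain `g` (from `i` to `j`) for each `g ∈ A`. -/
def gainComplete (A : Set ℤ) (n : ℕ) : IntegralGainGraph (Fin n) where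
  Edge := {p : Fin n × Fin n // p.1 < p.2} × A
  tail e := e.1.val.1
  head e := e.1.val.2
  gain e := e.2.val

/-- The Catalan graph `{0, ±1} K_n`. -/
def catalan (n : ℕ) : IntegralGainGraph (Fin n) := gainComplete {-1, 0, 1} n

/-- The hollow Catalan graph `{±1} K_n`. -/
def hollowCatalan (n : ℕ) : IntegralGainGraph (Fin n) := gainComplete {-1, 1} n

/-- The hyperplane `x_j = x_i + g` of an edge from `i` to `j` with gain `g`. -/
def hyperplane {V : Type} (Φ : IntegralGainGraph V) (e : Φ.Edge) : Set (V → ℝ) :=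
  {x | x (Φ.head e) = x (Φ.tail e) + (Φ.gain e : ℝ)}

/-- The affinographic hyperplane arrangement of an integral gain graph. -/
def arrangement {V : Type} (Φ : IntegralGainGraph V) : Set (Set (V → ℝ)) :=
  {H | ∃ e : Φ.Edge, H = Φ.hyperplane e}

end IntegralGainGraph

/-- The regions of an arrangement `𝓐` of hyperplanes in a space `E`: the connected components of
the complement of the union of `𝓐`. -/
def arrangementRegions {E : Type} [TopologicalSpace E] (𝓐 : Set (Set E)) : Set (Set E) :=
  {R | ∃ x ∈ (⋃₀ 𝓐)ᶜ, R = connectedComponentIn (⋃₀ 𝓐)ᶜ x}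

/-- The number of regions of the Catalan arrangement in `ℝⁿ`. -/
noncomputable def catalanRegionCount (n : ℕ) : ℕ :=
  (arrangementRegions (IntegralGainGraph.catalan n).arrangement).ncard

/-- The number of regions of the semiorder arrangement in `ℝⁿ`. -/
noncomputable def semiorderRegionCount (n : ℕ) : ℕ :=
  (arrangementRegions (IntegralGainGraph.hollowCatalan n).arrangement).ncard

/-- The number of cycles of a permutation; a fixed point counts as a cycle of length one. -/
noncomputable def permCycleCount {n : ℕ} (σ : Equiv.Perm (Fin n)) : ℕ :=
  Nat.card (Quotient (Equiv.Perm.SameCycle.setoid σ))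

/-- The unsigned Stirling number of the first kind `c(n, j)`: the number of permutations of an
`n`-element set that have exactly `j` cycles. -/
noncomputable def unsignedStirlingFirst (n j : ℕ) : ℕ :=
  Nat.card {σ : Equiv.Perm (Fin n) // permCycleCount σ = j}

/-!
A region of the semiorder arrangement is determined by the relation `x i + 1 < x j` that its points
induce on the index set, and every relation induced by some `x : Fin n → ℝ` occurs, because `x` can
be perturbed off the hyperplanes (`exists_generic`). So the regions of the semiorder arrangement are
the labelled semiorders (`unitOrders`), and the regions of the Catalan arrangement are the pairs of a
semiorder `P` and a linear order `L` induced simultaneously by one generic `x`.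

Call two indices twins for `P` if they have the same `P`-comparabilities. The values of any
representation of `P` order the twin classes in a way that depends on `P` only (`Below`), while twins
may be ordered arbitrarily. Hence, after one representation `x` of `P` is chosen, the linear orders
compatible with `P` are the orders of the `x ∘ σ`, each for exactly one permutation `σ` that maps
every index to a twin (`Respects`), and the regions of the Catalan arrangement are equinumerous with
the pairs `(P, σ)` where `σ` respects `P` (`catalanRegionCount_eq_card_pairs`).

Counting these pairs by `σ` instead, a semiorder respected by `σ` is the same thing as a semiorder on
the set of cycles of `σ` (`card_respected`). Summing over `σ`, grouped by the number of cycles,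
gives the formula.
-/

/-! ### Regions as fibres of a sign map -/

/-- If `s` is locally constant on the complement of the arrangement and has preconnected fibres
there, then the regions are these fibres. -/
theorem ncard_arrangementRegions {E T : Type} [TopologicalSpace E] (𝓐 : Set (Set E)) (s : E → T)
    (hloc : ∀ x ∈ (⋃₀ 𝓐)ᶜ, ∀ᶠ y in nhdsWithin x (⋃₀ 𝓐)ᶜ, s y = s x)
    (hconn : ∀ x ∈ (⋃₀ 𝓐)ᶜ, IsPreconnected {y | y ∈ (⋃₀ 𝓐)ᶜ ∧ s y = s x}) :
    (arrangementRegions 𝓐).ncard = (s '' (⋃₀ 𝓐)ᶜ).ncard := by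
  have key : ∀ x ∈ (⋃₀ 𝓐)ᶜ,
      connectedComponentIn (⋃₀ 𝓐)ᶜ x = {y | y ∈ (⋃₀ 𝓐)ᶜ ∧ s y = s x} := by
    intro x hx
    apply Set.Subset.antisymm
    · intro y hy
      refine ⟨connectedComponentIn_subset _ _ hy, ?_⟩
      let _ : TopologicalSpace T := ⊥
      have _ : DiscreteTopology T := ⟨rfl⟩
      have hc : ContinuousOn s (⋃₀ 𝓐)ᶜ := fun z hz =>
        tendsto_nhds_of_eventually_eq (hloc z hz)
      exact isPreconnected_connectedComponentIn.constant
        (hc.mono (connectedComponentIn_subset _ x)) hy (mem_connectedComponentIn hx)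
    · exact (hconn x hx).subset_connectedComponentIn ⟨hx, rfl⟩ (fun y hy => hy.1)
  have himg : arrangementRegions 𝓐 =
      (fun t => {y | y ∈ (⋃₀ 𝓐)ᶜ ∧ s y = t}) '' (s '' (⋃₀ 𝓐)ᶜ) := by
    ext R
    constructor
    · rintro ⟨x, hx, rfl⟩
      exact ⟨s x, ⟨x, hx, rfl⟩, (key x hx).symm⟩
    · rintro ⟨_, ⟨x, hx, rfl⟩, rfl⟩
      exact ⟨x, hx, (key x hx).symm⟩
  rw [himg]
  apply Set.InjOn.ncard_image
  rintro _ ⟨x, hx, rfl⟩ _ ⟨y, hy, rfl⟩ h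
  have hxm : x ∈ {z | z ∈ (⋃₀ 𝓐)ᶜ ∧ s z = s x} := ⟨hx, rfl⟩
  have h' : {z | z ∈ (⋃₀ 𝓐)ᶜ ∧ s z = s x} = {z | z ∈ (⋃₀ 𝓐)ᶜ ∧ s z = s y} := h
  rw [h'] at hxm
  exact hxm.2

/-! ### The relations induced by a real vector -/

/-- The semiorder on `V` represented by `x`: `i` precedes `j` if `x j` exceeds `x i` by more
than `1`. -/
def unitOrder {V : Type} (x : V → ℝ) : V → V → Prop := fun i j => x i + 1 < x j

/-- The strict order of the values of `x`. -/
def valueOrder {V : Type} (x : V → ℝ) : V → V → Prop := fun i j => x i < x j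

/-- The semiorders on `V`, encoded as the relations that have a unit representation. -/
def unitOrders (V : Type) : Set (V → V → Prop) := Set.range unitOrder

theorem compl_sUnion_hollowCatalan (n : ℕ) :
    (⋃₀ (IntegralGainGraph.hollowCatalan n).arrangement)ᶜ =
      {x : Fin n → ℝ | ∀ i j, x i + 1 ≠ x j} := by
  ext x
  simp only [IntegralGainGraph.arrangement, IntegralGainGraph.hyperplane,
    IntegralGainGraph.hollowCatalan, IntegralGainGraph.gainComplete, Set.mem_compl_iff,
    Set.mem_sUnion, Set.mem_ofPred_eq, not_exists, not_and]
  constructor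
  · intro h i j hij
    rcases lt_trichotomy i j with hlt | rfl | hlt
    · exact h _ ⟨⟨⟨(i, j), hlt⟩, ⟨1, by simp⟩⟩, rfl⟩ (by simp [← hij])
    · linarith
    · exact h _ ⟨⟨⟨(j, i), hlt⟩, ⟨-1, by simp⟩⟩, rfl⟩ (by simp [← hij])
  · rintro h _ ⟨⟨⟨⟨i, j⟩, hlt⟩, ⟨g, hg⟩⟩, rfl⟩ hx
    simp only [Set.mem_ofPred_eq] at hx
    rcases hg with rfl | rfl
    · exact h j i (by rw [hx]; push_cast; ring)
    · exact h i j (by rw [hx]; push_cast; ring)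

theorem compl_sUnion_catalan (n : ℕ) :
    (⋃₀ (IntegralGainGraph.catalan n).arrangement)ᶜ =
      {x : Fin n → ℝ | (∀ i j, x i + 1 ≠ x j) ∧ Function.Injective x} := by
  ext x
  simp only [IntegralGainGraph.arrangement, IntegralGainGraph.hyperplane,
    IntegralGainGraph.catalan, IntegralGainGraph.gainComplete, Set.mem_compl_iff,
    Set.mem_sUnion, Set.mem_ofPred_eq, not_exists, not_and]
  constructor
  · intro h
    refine ⟨fun i j hij => ?_, fun i j hij => ?_⟩
    · rcases lt_trichotomy i j with hlt | rfl | hlt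
      · exact h _ ⟨⟨⟨(i, j), hlt⟩, ⟨1, by simp⟩⟩, rfl⟩ (by simp [← hij])
      · linarith
      · exact h _ ⟨⟨⟨(j, i), hlt⟩, ⟨-1, by simp⟩⟩, rfl⟩ (by simp [← hij])
    · by_contra hne
      rcases lt_or_gt_of_ne hne with hlt | hlt
      · exact h _ ⟨⟨⟨(i, j), hlt⟩, ⟨0, by simp⟩⟩, rfl⟩ (by simp [hij])
      · exact h _ ⟨⟨⟨(j, i), hlt⟩, ⟨0, by simp⟩⟩, rfl⟩ (by simp [hij])
  · rintro ⟨h, hinj⟩ _ ⟨⟨⟨⟨i, j⟩, hlt⟩, ⟨g, hg⟩⟩, rfl⟩ hx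
    simp only [Set.mem_ofPred_eq] at hx
    rcases hg with rfl | rfl | rfl
    · exact h j i (by rw [hx]; push_cast; ring)
    · exact hlt.ne (hinj (by rw [hx]; push_cast; ring))
    · exact h i j (by rw [hx]; push_cast; ring)

theorem eventually_lt_iff {E : Type} [TopologicalSpace E] {f g : E → ℝ} (hf : Continuous f)
    (hg : Continuous g) {x : E} (hx : f x ≠ g x) : ∀ᶠ y in nhds x, (f y < g y ↔ f x < g x) := by
  rcases lt_or_gt_of_ne hx with h | h
  · filter_upwards [(isOpen_lt hf hg).mem_nhds h] with y hy
    exact iff_of_true hy h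
  · filter_upwards [(isOpen_lt hg hf).mem_nhds h] with y hy
    exact iff_of_false (lt_asymm hy) (lt_asymm h)

theorem eventually_unitOrder_eq {n : ℕ} {x : Fin n → ℝ} (hx : ∀ i j, x i + 1 ≠ x j) :
    ∀ᶠ y in nhds x, unitOrder y = unitOrder x := by
  have h : ∀ᶠ y in nhds x, ∀ i j, (y i + 1 < y j ↔ x i + 1 < x j) := by
    simp only [Filter.eventually_all]
    exact fun i j => eventually_lt_iff (f := fun y : Fin n → ℝ => y i + 1)
      (g := fun y => y j) (by fun_prop) (by fun_prop) (hx i j)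
  filter_upwards [h] with y hy
  exact funext₂ fun i j => propext (hy i j)

theorem eventually_valueOrder_eq {n : ℕ} {x : Fin n → ℝ} (hx : Function.Injective x) :
    ∀ᶠ y in nhds x, valueOrder y = valueOrder x := by
  have h : ∀ᶠ y in nhds x, ∀ i j, (y i < y j ↔ x i < x j) := by
    simp only [Filter.eventually_all]
    intro i j
    rcases eq_or_ne i j with rfl | hij
    · simp
    · exact eventually_lt_iff (f := fun y : Fin n → ℝ => y i)
        (g := fun y => y j) (by fun_prop) (by fun_prop) (hx.ne hij)
  filter_upwards [h] with y hy
  exact funext₂ fun i j => propext (hy i j)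

theorem convex_unitOrder_fiber {V : Type} (P : V → V → Prop) :
    Convex ℝ {y : V → ℝ | (∀ i j, y i + 1 ≠ y j) ∧ unitOrder y = P} := by
  rintro a ⟨ha, rfl⟩ b ⟨hb, hab⟩ s t hs ht hst
  have key : ∀ i j, (a i + 1 < a j → s * a i + t * b i + 1 < s * a j + t * b j) ∧
      (¬ a i + 1 < a j → s * a j + t * b j < s * a i + t * b i + 1) := by
    intro i j
    have hiff : b i + 1 < b j ↔ a i + 1 < a j := iff_of_eq (congrFun₂ hab i j)
    constructor
    · intro h
      have := convex_Ioi (1 : ℝ) (x := a j - a i) (by simp; linarith) (y := b j - b i)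
        (by simp; linarith [hiff.2 h]) hs ht hst
      simp only [smul_eq_mul, Set.mem_Ioi] at this
      linarith
    · intro h
      have hb' := mt hiff.1 h
      have := convex_Iio (1 : ℝ) (x := a j - a i)
        (by have := lt_of_le_of_ne (not_lt.1 h) (ha i j).symm; simp; linarith) (y := b j - b i)
        (by have := lt_of_le_of_ne (not_lt.1 hb') (hb i j).symm; simp; linarith) hs ht hst
      simp only [smul_eq_mul, Set.mem_Iio] at this
      linarith
  refine ⟨fun i j => ?_, ?_⟩
  · simp only [Pi.add_apply, Pi.smul_apply, smul_eq_mul]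
    by_cases h : a i + 1 < a j
    · exact ((key i j).1 h).ne
    · exact ((key i j).2 h).ne'
  · funext i j
    simp only [unitOrder, Pi.add_apply, Pi.smul_apply, smul_eq_mul, eq_iff_iff]
    by_cases h : a i + 1 < a j
    · exact iff_of_true ((key i j).1 h) h
    · exact iff_of_false ((key i j).2 h).not_gt h

theorem convex_valueOrder_fiber {V : Type} (L : V → V → Prop) :
    Convex ℝ {y : V → ℝ | Function.Injective y ∧ valueOrder y = L} := by
  rintro a ⟨ha, rfl⟩ b ⟨hb, hab⟩ s t hs ht hst
  have key : ∀ i j, a i < a j → s * a i + t * b i < s * a j + t * b j := by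
    intro i j h
    have hbij : b i < b j := (iff_of_eq (congrFun₂ hab i j)).2 h
    have := convex_Ioi (0 : ℝ) (x := a j - a i) (by simp; linarith) (y := b j - b i)
      (by simp; linarith) hs ht hst
    simp only [smul_eq_mul, Set.mem_Ioi] at this
    linarith
  refine ⟨fun i j hij => ?_, ?_⟩
  · simp only [Pi.add_apply, Pi.smul_apply, smul_eq_mul] at hij
    by_contra hne
    rcases lt_or_gt_of_ne (ha.ne hne) with h | h
    · exact (key i j h).ne hij
    · exact (key j i h).ne' hij
  · funext i j
    simp only [valueOrder, Pi.add_apply, Pi.smul_apply, smul_eq_mul, eq_iff_iff]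
    refine ⟨fun h => ?_, key i j⟩
    rcases lt_trichotomy (a i) (a j) with h' | h' | h'
    · exact h'
    · rw [ha h'] at h
      exact absurd h (lt_irrefl _)
    · exact absurd h (key j i h').not_gt

/-- Shrinking `x` towards a small injective vector turns the non-strict inequalities
`x j ≤ x i + 1` into strict ones, keeps the strict ones, and separates equal values. -/
theorem exists_generic {n : ℕ} (x : Fin n → ℝ) :
    ∃ y : Fin n → ℝ, (∀ i j, y i + 1 ≠ y j) ∧ Function.Injective y ∧
      unitOrder y = unitOrder x := by
  let c : Fin n → ℝ := fun i => (i : ℝ) / (n + 1)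
  have hn : (0 : ℝ) < n + 1 := by positivity
  have hc0 : ∀ i, 0 ≤ c i := fun i => by positivity
  have hc1 : ∀ i, c i < 1 := fun i => by
    have : ((i : ℕ) : ℝ) < n := by exact_mod_cast i.2
    rw [div_lt_one hn]
    linarith
  have hcinj : Function.Injective c := fun i j h => by
    have h' : ((i : ℕ) : ℝ) = (j : ℕ) := by
      simpa [c, div_left_inj' hn.ne'] using h
    exact Fin.ext (by exact_mod_cast h')
  let f : ℝ → Fin n → ℝ := fun δ i => (1 - δ) * x i + δ * c i
  have hcont : ∀ i, Continuous fun δ => f δ i := fun i => by fun_prop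
  have hf0 : ∀ i, f 0 i = x i := fun i => by simp [f]
  have hlt : ∀ i j, ∀ᶠ δ in nhdsWithin (0 : ℝ) (Set.Ioi 0), x i + 1 < x j → f δ i + 1 < f δ j := by
    intro i j
    by_cases h : x i + 1 < x j
    · have : ∀ᶠ δ in nhds (0 : ℝ), f δ i + 1 < f δ j :=
        (isOpen_lt ((hcont i).add continuous_const) (hcont j)).mem_nhds (by
          simpa [hf0] using h)
      filter_upwards [this.filter_mono nhdsWithin_le_nhds] with δ hδ _ using hδ
    · exact Filter.Eventually.of_forall fun _ h' => absurd h' h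
  have hge : ∀ i j, ∀ᶠ δ in nhdsWithin (0 : ℝ) (Set.Ioi 0), x j ≤ x i + 1 → f δ j < f δ i + 1 := by
    intro i j
    filter_upwards [Ioo_mem_nhdsGT (zero_lt_one' ℝ)] with δ hδ h
    have h1 : (1 - δ) * x j ≤ (1 - δ) * (x i + 1) :=
      mul_le_mul_of_nonneg_left h (by linarith [hδ.2])
    have h2 : δ * c j < δ * (c i + 1) :=
      mul_lt_mul_of_pos_left (by linarith [hc0 i, hc1 j]) hδ.1
    simp only [f]
    linarith
  have hne : ∀ i j, ∀ᶠ δ in nhdsWithin (0 : ℝ) (Set.Ioi 0), i ≠ j → f δ i ≠ f δ j := by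
    intro i j
    by_cases h : x i = x j
    · filter_upwards [self_mem_nhdsWithin] with δ hδ hij heq
      simp only [f, h, add_right_inj] at heq
      exact hij (hcinj (mul_left_cancel₀ (ne_of_gt hδ) heq))
    · have : ∀ᶠ δ in nhds (0 : ℝ), f δ i ≠ f δ j :=
        (isOpen_ne_fun (hcont i) (hcont j)).mem_nhds (by simpa [hf0] using h)
      filter_upwards [this.filter_mono nhdsWithin_le_nhds] with δ hδ _ using hδ
  obtain ⟨δ, h1, h2, h3⟩ := ((Filter.eventually_all.2 fun i => Filter.eventually_all.2 (hlt i)).and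
    ((Filter.eventually_all.2 fun i => Filter.eventually_all.2 (hge i)).and
      (Filter.eventually_all.2 fun i => Filter.eventually_all.2 (hne i)))).exists
  refine ⟨f δ, fun i j => ?_, fun i j hij => by_contra fun h => h3 i j h hij, ?_⟩
  · rcases lt_or_ge (x i + 1) (x j) with h | h
    · exact (h1 i j h).ne
    · exact (h2 i j h).ne'
  · funext i j
    refine propext ⟨fun h => ?_, h1 i j⟩
    by_contra hcon
    exact lt_asymm h (h2 i j (not_lt.1 hcon))

theorem semiorderRegionCount_eq (n : ℕ) :
    semiorderRegionCount n = Nat.card (unitOrders (Fin n)) := by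
  rw [semiorderRegionCount, ncard_arrangementRegions _ unitOrder, compl_sUnion_hollowCatalan,
    ← Nat.card_coe_set_eq]
  · congr 2
    ext P
    constructor
    · rintro ⟨x, -, rfl⟩
      exact ⟨x, rfl⟩
    · rintro ⟨x, rfl⟩
      obtain ⟨y, hy, -, hyx⟩ := exists_generic x
      exact ⟨y, hy, hyx⟩
  · rw [compl_sUnion_hollowCatalan]
    exact fun x hx => (eventually_unitOrder_eq hx).filter_mono nhdsWithin_le_nhds
  · rw [compl_sUnion_hollowCatalan]
    exact fun x _ => (convex_unitOrder_fiber (unitOrder x)).isPreconnected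

/-- The pairs of a semiorder and a linear order induced by one and the same point off the
hyperplanes of the Catalan arrangement. -/
def orderPairs (n : ℕ) : Set ((Fin n → Fin n → Prop) × (Fin n → Fin n → Prop)) :=
  (fun x => (unitOrder x, valueOrder x)) ''
    {x : Fin n → ℝ | (∀ i j, x i + 1 ≠ x j) ∧ Function.Injective x}

theorem catalanRegionCount_eq (n : ℕ) :
    catalanRegionCount n = Nat.card (orderPairs n) := by
  rw [catalanRegionCount, ncard_arrangementRegions _ (fun x => (unitOrder x, valueOrder x)),
    compl_sUnion_catalan, ← Nat.card_coe_set_eq]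
  · rfl
  · rw [compl_sUnion_catalan]
    intro x hx
    filter_upwards [(eventually_unitOrder_eq hx.1).filter_mono nhdsWithin_le_nhds,
      (eventually_valueOrder_eq hx.2).filter_mono nhdsWithin_le_nhds] with y h1 h2
    rw [h1, h2]
  · rw [compl_sUnion_catalan]
    intro x _
    have h := ((convex_unitOrder_fiber (unitOrder x)).inter
      (convex_valueOrder_fiber (valueOrder x))).isPreconnected
    convert h using 1
    ext y
    simp only [Set.mem_ofPred_eq, Set.mem_inter_iff, Prod.mk.injEq]
    tauto

/-! ### Twins and the order of twin classes -/

/-- Two elements are twins for `P` if they stand in the same relation to every element. -/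
def Twin {V : Type} (P : V → V → Prop) (i j : V) : Prop :=
  ∀ k, (P i k ↔ P j k) ∧ (P k i ↔ P k j)

/-- A permutation respects `P` if it moves every element to a twin. -/
def Respects {V : Type} (P : V → V → Prop) (σ : Equiv.Perm V) : Prop := ∀ i, Twin P (σ i) i

/-- For a semiorder `P`, the strict order of the twin classes that every representation of `P`
obeys: some element witnesses that `i` lies below `j`. -/
def Below {V : Type} (P : V → V → Prop) (i j : V) : Prop :=
  ∃ k, (P i k ∧ ¬ P j k) ∨ (P k j ∧ ¬ P k i)

theorem lt_of_below {V : Type} {x : V → ℝ} {i j : V} (h : Below (unitOrder x) i j) :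
    x i < x j := by
  obtain ⟨k, ⟨h1, h2⟩ | ⟨h1, h2⟩⟩ := h <;> simp only [unitOrder] at h1 h2 <;> linarith

theorem below_or_below {V : Type} {P : V → V → Prop} {i j : V} (h : ¬ Twin P i j) :
    Below P i j ∨ Below P j i := by
  by_contra hcon
  simp only [Below, not_or, not_exists] at hcon
  exact h fun k => by have := hcon.1 k; have := hcon.2 k; tauto

theorem Twin.below_congr_left {V : Type} {P : V → V → Prop} {i j k : V} (h : Twin P i j)
    (hi : Below P i k) : Below P j k := by
  obtain ⟨l, hl⟩ := hi
  exact ⟨l, by rwa [← (h l).1, ← (h l).2]⟩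

theorem Twin.below_congr_right {V : Type} {P : V → V → Prop} {i j k : V} (h : Twin P i j)
    (hi : Below P k i) : Below P k j := by
  obtain ⟨l, hl⟩ := hi
  exact ⟨l, by rwa [← (h l).1, ← (h l).2]⟩

theorem Respects.apply_iff {V : Type} {P : V → V → Prop} {σ : Equiv.Perm V} (h : Respects P σ)
    (i j : V) : P (σ i) (σ j) ↔ P i j :=
  ((h i (σ j)).1).trans (h j i).2

theorem exists_perm_valueOrder_eq {n : ℕ} {x y : Fin n → ℝ} (hx : Function.Injective x)
    (hy : Function.Injective y) :
    ∃ σ : Equiv.Perm (Fin n), valueOrder (x ∘ σ) = valueOrder y := by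
  refine ⟨(Tuple.sort y).symm.trans (Tuple.sort x), ?_⟩
  have hsx := (Tuple.monotone_sort x).strictMono_of_injective
    (hx.comp (Tuple.sort x).injective)
  have hsy := (Tuple.monotone_sort y).strictMono_of_injective
    (hy.comp (Tuple.sort y).injective)
  funext i j
  obtain ⟨a, rfl⟩ := (Tuple.sort y).surjective i
  obtain ⟨b, rfl⟩ := (Tuple.sort y).surjective j
  simp only [valueOrder, Function.comp_apply, Equiv.trans_apply, Equiv.symm_apply_apply]
  exact propext ((hsx.lt_iff_lt (a := a) (b := b)).trans hsy.lt_iff_lt.symm)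

theorem perm_eq_of_valueOrder_eq {n : ℕ} {x : Fin n → ℝ} (hx : Function.Injective x)
    {σ τ : Equiv.Perm (Fin n)} (h : valueOrder (x ∘ σ) = valueOrder (x ∘ τ)) : σ = τ := by
  have h1 := Tuple.monotone_sort (x ∘ σ)
  have h2 : Monotone (x ∘ (τ * Tuple.sort (x ∘ σ) : Equiv.Perm (Fin n))) := by
    intro a b hab
    have := (iff_of_eq (congrFun₂ h (Tuple.sort (x ∘ σ) b) (Tuple.sort (x ∘ σ) a))).2
    exact not_lt.1 fun hlt => (this hlt).not_ge (h1 hab)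
  have h3 := Tuple.unique_monotone (f := x) (σ := σ * Tuple.sort (x ∘ σ)) h1 h2
  have h4 : σ * Tuple.sort (x ∘ σ) = τ * Tuple.sort (x ∘ σ) :=
    Equiv.ext fun i => hx (congrFun h3 i)
  exact mul_right_cancel h4

/-- If two representations of a semiorder are related by the permutation `σ`, then `σ` moves no
element to a higher twin class: otherwise the elements that `y` places weakly below `i` would all
be placed strictly below `σ i` by `x`, and there are too many of them. -/
theorem not_below_perm {V : Type} [Finite V] {x y : V → ℝ} {σ : Equiv.Perm V}
    (hP : unitOrder x = unitOrder y) (hσ : valueOrder (x ∘ σ) = valueOrder y) (i : V) :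
    ¬ Below (unitOrder x) i (σ i) := by
  intro hi
  have hsub : {l | y l ≤ y i} ⊆ σ.symm ⁻¹' {l | y l < y i} := by
    intro l hl
    have hl' : ¬ Below (unitOrder x) i l := fun h =>
      (lt_of_below (hP ▸ h)).not_ge hl
    have hlt : x l < x (σ i) := by
      by_cases ht : Twin (unitOrder x) i l
      · exact lt_of_below (ht.below_congr_left hi)
      · exact (lt_of_below ((below_or_below ht).resolve_left hl')).trans (lt_of_below hi)
    have := (iff_of_eq (congrFun₂ hσ (σ.symm l) i)).1
    exact this (by simpa [valueOrder] using hlt)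
  have hcard := Set.ncard_le_ncard hsub (Set.toFinite _)
  rw [← Equiv.image_eq_preimage_symm, Set.ncard_image_of_injective _ σ.injective] at hcard
  have hss : {l | y l < y i} ⊂ {l | y l ≤ y i} :=
    ⟨fun l (hl : y l < y i) => hl.le, fun h => lt_irrefl (y i) (h (le_refl (y i)))⟩
  exact (Set.ncard_lt_ncard hss (Set.toFinite _)).not_ge hcard

/-- The dual of `not_below_perm`, obtained by negating all values. -/
theorem not_perm_below {V : Type} [Finite V] {x y : V → ℝ} {σ : Equiv.Perm V}
    (hP : unitOrder x = unitOrder y) (hσ : valueOrder (x ∘ σ) = valueOrder y) (i : V) :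
    ¬ Below (unitOrder x) (σ i) i := by
  have hneg : ∀ z : V → ℝ, unitOrder (-z) = fun a b => unitOrder z b a := fun z => by
    funext a b
    simp only [unitOrder, Pi.neg_apply, eq_iff_iff]
    constructor <;> intro h <;> linarith
  have hP' : unitOrder (-x) = unitOrder (-y) := by rw [hneg, hneg, hP]
  have hσ' : valueOrder (-x ∘ σ) = valueOrder (-y) := by
    funext a b
    simpa [valueOrder] using congrFun₂ hσ b a
  intro h
  refine not_below_perm hP' hσ' i ?_
  obtain ⟨k, hk⟩ := h
  rw [hneg]
  exact ⟨k, hk.symm⟩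

theorem respects_of_valueOrder_eq {V : Type} [Finite V] {x y : V → ℝ} {σ : Equiv.Perm V}
    (hP : unitOrder x = unitOrder y) (hσ : valueOrder (x ∘ σ) = valueOrder y) :
    Respects (unitOrder x) σ := fun i => by
  by_contra h
  exact (below_or_below h).elim (not_perm_below hP hσ i) (not_below_perm hP hσ i)

theorem Respects.unitOrder_comp {V : Type} {x : V → ℝ} {σ : Equiv.Perm V}
    (h : Respects (unitOrder x) σ) : unitOrder (x ∘ σ) = unitOrder x :=
  funext₂ fun i j => propext (h.apply_iff i j)

/-! ### Counting pairs of a semiorder and a permutation -/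

theorem catalanRegionCount_eq_card_pairs (n : ℕ) :
    catalanRegionCount n =
      Nat.card {p : unitOrders (Fin n) × Equiv.Perm (Fin n) // Respects p.1.1 p.2} := by
  have hrep : ∀ P : unitOrders (Fin n), ∃ x : Fin n → ℝ,
      (∀ i j, x i + 1 ≠ x j) ∧ Function.Injective x ∧ unitOrder x = P.1 := by
    rintro ⟨_, x, rfl⟩
    exact exists_generic x
  choose x hx hinj hxP using hrep
  rw [catalanRegionCount_eq]
  symm
  refine Nat.card_congr (Equiv.ofBijective
    (fun p => ⟨(p.1.1.1, valueOrder (x p.1.1 ∘ p.1.2)), x p.1.1 ∘ p.1.2,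
      ⟨fun i j => hx _ _ _, (hinj _).comp p.1.2.injective⟩, ?_⟩) ⟨?_, ?_⟩)
  · have h := p.2
    rw [← hxP] at h
    simp only [h.unitOrder_comp, hxP]
  · rintro ⟨⟨P, σ⟩, hσ⟩ ⟨⟨Q, τ⟩, hτ⟩ h
    have h' := Prod.ext_iff.1 (congrArg Subtype.val h)
    obtain rfl : P = Q := Subtype.ext h'.1
    exact Subtype.ext (Prod.ext rfl (perm_eq_of_valueOrder_eq (hinj P) h'.2))
  · rintro ⟨_, y, ⟨_, hy⟩, rfl⟩
    obtain ⟨σ, hσ⟩ := exists_perm_valueOrder_eq (hinj ⟨unitOrder y, y, rfl⟩) hy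
    refine ⟨⟨(⟨unitOrder y, y, rfl⟩, σ), ?_⟩, ?_⟩
    · have := respects_of_valueOrder_eq (hxP ⟨unitOrder y, y, rfl⟩) hσ
      rwa [hxP] at this
    · simp only [hσ]

theorem Twin.trans {V : Type} {P : V → V → Prop} {i j k : V} (h : Twin P i j) (h' : Twin P j k) :
    Twin P i k := fun l => ⟨(h l).1.trans (h' l).1, (h l).2.trans (h' l).2⟩

theorem Twin.symm {V : Type} {P : V → V → Prop} {i j : V} (h : Twin P i j) : Twin P j i :=
  fun l => ⟨(h l).1.symm, (h l).2.symm⟩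

theorem Respects.twin_of_sameCycle {V : Type} [Finite V] {P : V → V → Prop} {σ : Equiv.Perm V}
    (h : Respects P σ) {i j : V} (hij : σ.SameCycle i j) : Twin P i j := by
  obtain ⟨m, rfl⟩ := hij.exists_nat_pow_eq
  induction m with
  | zero => exact fun k => ⟨Iff.rfl, Iff.rfl⟩
  | succ m ih =>
    rw [pow_succ', Equiv.Perm.mul_apply]
    exact (ih ⟨m, by simp⟩).trans (h _).symm

theorem card_unitOrders_congr {V W : Type} (e : V ≃ W) :
    Nat.card (unitOrders V) = Nat.card (unitOrders W) := by
  refine Nat.card_congr (Equiv.subtypeEquiv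
    (Equiv.arrowCongr e (Equiv.arrowCongr e (Equiv.refl Prop))) fun P => ?_)
  constructor
  · rintro ⟨x, rfl⟩
    exact ⟨x ∘ e.symm, rfl⟩
  · rintro ⟨x, hx⟩
    refine ⟨x ∘ e, funext₂ fun i j => ?_⟩
    simpa [unitOrder, Equiv.arrowCongr] using congrFun₂ hx (e i) (e j)

/-- A semiorder respected by `σ` is constant on cycles, so it is pulled back from a unique
semiorder on the set of cycles. -/
theorem card_respected {n : ℕ} (σ : Equiv.Perm (Fin n)) :
    Nat.card {P : unitOrders (Fin n) // Respects P.1 σ} =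
      semiorderRegionCount (permCycleCount σ) := by
  let Q := Quotient (Equiv.Perm.SameCycle.setoid σ)
  let mk : Fin n → Q := Quotient.mk _
  have hmk : ∀ i, mk (σ i) = mk i := fun i =>
    Quotient.sound (Equiv.Perm.sameCycle_apply_left.2 (Equiv.Perm.SameCycle.refl σ i))
  rw [semiorderRegionCount_eq]
  symm
  refine (card_unitOrders_congr (Finite.equivFin Q)).symm.trans ?_
  refine Nat.card_congr (Equiv.ofBijective
    (fun R => ⟨⟨fun i j => R.1 (mk i) (mk j), ?_⟩, fun i k => ?_⟩) ⟨?_, ?_⟩)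
  · obtain ⟨_, x, rfl⟩ := R
    exact ⟨x ∘ mk, rfl⟩
  · simp only [hmk, and_self]
  · rintro R S h
    apply Subtype.ext
    funext a b
    obtain ⟨i, rfl⟩ := Quotient.exists_rep a
    obtain ⟨j, rfl⟩ := Quotient.exists_rep b
    exact congrFun₂ (congrArg (fun T => T.1.1) h) i j
  · rintro ⟨⟨_, x, rfl⟩, hσ⟩
    refine ⟨⟨unitOrder (x ∘ Quotient.out), _, rfl⟩, ?_⟩
    apply Subtype.ext
    apply Subtype.ext
    funext i j
    have hout : ∀ i, Twin (unitOrder x) (mk i).out i := fun i =>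
      hσ.twin_of_sameCycle (Quotient.exact (Quotient.out_eq (mk i)))
    exact propext (((hout i _).1).trans (hout j _).2)

theorem permCycleCount_le {n : ℕ} (σ : Equiv.Perm (Fin n)) : permCycleCount σ ≤ n := by
  simpa [permCycleCount] using
    Nat.card_le_card_of_surjective (Quotient.mk (Equiv.Perm.SameCycle.setoid σ))
      Quotient.mk_surjective

theorem corollary7p2 (n : ℕ) :
    catalanRegionCount n =
      ∑ j ∈ Finset.range (n + 1), unsignedStirlingFirst n j * semiorderRegionCount j := by
  have hswap : {p : unitOrders (Fin n) × Equiv.Perm (Fin n) // Respects p.1.1 p.2} ≃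
      Σ σ : Equiv.Perm (Fin n), {P : unitOrders (Fin n) // Respects P.1 σ} :=
    { toFun := fun p => ⟨p.1.2, p.1.1, p.2⟩
      invFun := fun q => ⟨(q.2.1, q.1), q.2.2⟩
      left_inv := fun _ => rfl
      right_inv := fun _ => rfl }
  rw [catalanRegionCount_eq_card_pairs, Nat.card_congr hswap, Nat.card_sigma]
  simp only [card_respected]
  rw [← Finset.sum_fiberwise_of_maps_to (t := Finset.range (n + 1)) (g := permCycleCount)
    fun σ _ => Finset.mem_range_succ_iff.2 (permCycleCount_le σ)]
  refine Finset.sum_congr rfl fun j _ => ?_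
  rw [Finset.sum_congr rfl fun σ hσ => by rw [(Finset.mem_filter.1 hσ).2], Finset.sum_const,
    smul_eq_mul, unsignedStirlingFirst, Nat.card_eq_fintype_card, Fintype.card_subtype]
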